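/- Let $M,N\ge 2$ be integers and $0<p_0<1$. On $[0,1)$ consider the $N$-adic map $f_0(x)=Nx \pmod 1$ and the $M$ contractions $f_i(x)=(x+i-1)/M$, $1\le i\le M$. Let $\nu$ be the Bernoulli (i.i.d. product) measure on $\{0,1,\dots,M\}^{\mathbb N}$ with probability vector $\big(p_0,\tfrac{1-p_0}{M},\dots,\tfrac{1-p_0}{M}\big)$, and for $\omega=(\omega_0,\omega_1,\dots)$ put $f^0_\omega=\mathrm{id}$ and $f^n_\omega=f_{\omega_{n-1}}\circ\cdots\circ f_{\omega_0}$. Assume that the Lyapunov exponent $$L_{p_0}=p_0\ln N-(1-p_0)\ln M,$$ which is the $\nu$-almost sure limit of $\frac1n\sum_{i=0}^{n-1}\ln f_{\omega_i}'$, vanishes: $L_{p_0}=0$. Then for every $\varepsilon>0$ and all $x,y\in[0,1)$, $$\lim_{n\to\infty}\frac1n\,\Big|\{\,0\le i<n \;;\; |f^i_\omega(x)-f^i_\omega(y)|<\varepsilon\,\}\Big|=1\qquad\text{for }\nu\text{-almost every }\omega .$$ -/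

import Mathlib

open MeasureTheory ProbabilityTheory Filter
open scoped Topology

namespace TwoPoint

/-- The maps of the iterated function system on `[0,1)`: the `N`-adic map `f₀ x = N x mod 1`, and
the `M` contractions `fᵢ x = (x + i - 1) / M` for `1 ≤ i ≤ M`. -/
noncomputable def ifsMap (M N : ℕ) (i : Fin (M + 1)) (x : ℝ) : ℝ :=
  if i = 0 then Int.fract ((N : ℝ) * x) else (x + ((i : ℕ) : ℝ) - 1) / (M : ℝ)

/-- Each map sends `[0,1)` into itself. -/
theorem ifsMap_mapsTo (M N : ℕ) (i : Fin (M + 1)) :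
    Set.MapsTo (ifsMap M N i) (Set.Ico 0 1) (Set.Ico 0 1) := by
  intro x hx
  unfold ifsMap
  split_ifs with h
  · exact ⟨Int.fract_nonneg _, Int.fract_lt_one _⟩
  · have h1 : 1 ≤ (i : ℕ) := Nat.one_le_iff_ne_zero.mpr (fun h0 => h (Fin.ext h0))
    have h2 : (i : ℕ) ≤ M := Nat.lt_succ_iff.mp i.isLt
    have h1' : (1 : ℝ) ≤ ((i : ℕ) : ℝ) := by exact_mod_cast h1
    have h2' : ((i : ℕ) : ℝ) ≤ (M : ℝ) := by exact_mod_cast h2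
    have hM : (0 : ℝ) < M := by linarith
    refine ⟨div_nonneg (by linarith [hx.1]) hM.le, ?_⟩
    rw [div_lt_one hM]
    linarith [hx.2]

/-- The random compositions `f_ω^n = f_{ω_{n-1}} ∘ ⋯ ∘ f_{ω_0}`, with `f_ω^0 = id`. -/
noncomputable def iter (M N : ℕ) (ω : ℕ → Fin (M + 1)) : ℕ → ℝ → ℝ
  | 0, x => x
  | n + 1, x => ifsMap M N (ω n) (iter M N ω n x)

/-- The probability vector `(p₀, (1 - p₀)/M, …, (1 - p₀)/M)`. -/
noncomputable def weight (M : ℕ) (p₀ : ℝ) (i : Fin (M + 1)) : ℝ :=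
  if i = 0 then p₀ else (1 - p₀) / (M : ℝ)

/-- The law of one symbol: the symbol `i` has mass `weight M p₀ i`. -/
noncomputable def symbolLaw (M : ℕ) (p₀ : ℝ) : Measure (Fin (M + 1)) :=
  ∑ i, ENNReal.ofReal (weight M p₀ i) • Measure.dirac i

/-- The Bernoulli measure `ν` on `{0, …, M}^ℕ`: the coordinates are independent, each with law
`symbolLaw M p₀`. -/
noncomputable def bernoulli (M : ℕ) (p₀ : ℝ) : Measure (ℕ → Fin (M + 1)) :=
  Measure.infinitePi (fun _ : ℕ => symbolLaw M p₀)

theorem weight_nonneg (M : ℕ) (p₀ : ℝ) (h0 : 0 < p₀) (h1 : p₀ < 1) (i : Fin (M + 1)) :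
    0 ≤ weight M p₀ i := by
  unfold weight
  split_ifs
  · exact h0.le
  · exact div_nonneg (by linarith) (Nat.cast_nonneg M)

theorem sum_weight (M : ℕ) (hM : 2 ≤ M) (p₀ : ℝ) : ∑ i, weight M p₀ i = 1 := by
  have hM' : (M : ℝ) ≠ 0 := by positivity
  rw [Fin.sum_univ_succ]
  simp only [weight, if_true, Fin.succ_ne_zero, if_false, Finset.sum_const, Finset.card_univ,
    Fintype.card_fin, nsmul_eq_mul]
  field_simp
  ring

theorem isProbabilityMeasure_symbolLaw (M : ℕ) (hM : 2 ≤ M) (p₀ : ℝ) (h0 : 0 < p₀)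
    (h1 : p₀ < 1) : IsProbabilityMeasure (symbolLaw M p₀) := by
  constructor
  simp only [symbolLaw, Measure.coe_finsetSum, Finset.sum_apply, Measure.smul_apply,
    measure_univ, smul_eq_mul, mul_one]
  rw [← ENNReal.ofReal_sum_of_nonneg (fun i _ => weight_nonneg M p₀ h0 h1 i), sum_weight M hM]
  simp

/-- The slope of the affine branches of the map `i`: `N` for `i = 0` and `1/M` for `i ≥ 1`. -/
noncomputable def slope (M N : ℕ) (i : Fin (M + 1)) : ℝ :=
  if i = 0 then (N : ℝ) else 1 / (M : ℝ)

/-- The Lyapunov exponent `L_{p₀} = p₀ ln N - (1 - p₀) ln M`. -/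
noncomputable def lyapunov (M N : ℕ) (p₀ : ℝ) : ℝ :=
  p₀ * Real.log N - (1 - p₀) * Real.log M

/-- `L_{p₀}` is the almost sure limit of the averages of the logarithms of the slopes met along
the random orbit. -/
theorem tendsto_lyapunov (M N : ℕ) (hM : 2 ≤ M) (p₀ : ℝ) (h0 : 0 < p₀) (h1 : p₀ < 1) :
    ∀ᵐ ω ∂(bernoulli M p₀), Tendsto
      (fun n : ℕ => (1 / (n : ℝ)) * ∑ i ∈ Finset.range n, Real.log (slope M N (ω i)))
      atTop (𝓝 (lyapunov M N p₀)) := by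
  have := isProbabilityMeasure_symbolLaw M hM p₀ h0 h1
  set g : Fin (M + 1) → ℝ := fun i => Real.log (slope M N i) with hg
  have hgm : Measurable g := measurable_of_finite g
  have hmap : ∀ i : ℕ, Measure.map (fun ω : ℕ → Fin (M + 1) => ω i) (bernoulli M p₀)
      = symbolLaw M p₀ := fun i => Measure.infinitePi_map_eval _ i
  have hint : Integrable g (symbolLaw M p₀) := Integrable.of_finite
  have : IsProbabilityMeasure (bernoulli M p₀) := by unfold bernoulli; infer_instance
  have hmean : ∫ ω, g (ω 0) ∂(bernoulli M p₀) = lyapunov M N p₀ := by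
    have h := integral_map (μ := bernoulli M p₀) (φ := fun ω : ℕ → Fin (M + 1) => ω 0)
      (measurable_pi_apply 0).aemeasurable (f := g) hgm.aestronglyMeasurable
    rw [← h, hmap 0, symbolLaw, integral_finsetSum_measure (fun i _ =>
      (integrable_dirac (by simp)).smul_measure ENNReal.ofReal_ne_top)]
    simp only [integral_smul_measure, integral_dirac, smul_eq_mul,
      ENNReal.toReal_ofReal (weight_nonneg M p₀ h0 h1 _)]
    have hM' : (M : ℝ) ≠ 0 := by positivity
    rw [Fin.sum_univ_succ]
    simp only [hg, weight, slope, lyapunov, if_true, Fin.succ_ne_zero, if_false, Finset.sum_const,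
      Finset.card_univ, Fintype.card_fin, nsmul_eq_mul, one_div, Real.log_inv]
    field_simp
    ring
  have key := strong_law_ae_real (μ := bernoulli M p₀)
    (fun (i : ℕ) (ω : ℕ → Fin (M + 1)) => g (ω i)) ?_ ?_ ?_
  · filter_upwards [key] with ω hω
    rw [hmean] at hω
    refine hω.congr (fun n => ?_)
    rw [one_div, div_eq_inv_mul]
  · exact Integrable.of_bound (C := ∑ i, ‖g i‖)
      (hgm.comp (measurable_pi_apply 0)).aestronglyMeasurable
      (ae_of_all _ (fun ω => Finset.single_le_sum (f := fun i => ‖g i‖)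
        (fun i _ => norm_nonneg _) (Finset.mem_univ (ω 0))))
  · have hind : iIndepFun (fun (i : ℕ) (ω : ℕ → Fin (M + 1)) => g (ω i)) (bernoulli M p₀) :=
      iIndepFun_infinitePi (P := fun _ : ℕ => symbolLaw M p₀) (X := fun _ => g) (fun _ => hgm)
    intro i j hij
    exact hind.indepFun hij
  · intro i
    have hid : IdentDistrib (fun ω : ℕ → Fin (M + 1) => ω i) (fun ω => ω 0)
        (bernoulli M p₀) (bernoulli M p₀) :=
      ⟨(measurable_pi_apply i).aemeasurable, (measurable_pi_apply 0).aemeasurable,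
        by rw [hmap i, hmap 0]⟩
    exact hid.comp hgm

end TwoPoint

/-!
The orbits of all points of `[0,1)` are followed together. Starting from the cell `[0,1)`, keep a
half-open interval that contains `f_ω^n x` for every `x`: a contraction divides its length by `M`,
the `N`-adic map multiplies the length by `N`, except that a cell with some `k / N` in its interior
is cut, and is then reset to `[0,1)`. Since `|f_ω^n x - f_ω^n y|` is less than the length of the
cell at time `n`, it suffices that cells of length at least `ε` have zero frequency
(`ae_eventually_sum_long_le`). A long cell is reset within a bounded time with probability bounded
below, so it suffices that resets have zero frequency (`ae_eventually_sum_reset_le`), that is, that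
the mean time between resets is infinite (`exists_lt_lifetime`).

For this, kill the motion at the first reset. The depth `-log len` has mean-zero increments because
`L_{p₀} = 0`, so its mean on survival decreases only through the cells that are cut
(`le_killedOp_depth`). All the maps preserve Lebesgue measure in mean, so a cell of length `l`
contains a given point with probability at most `l` (`cellMean_cellsAt_le`); hence the loss at a
step is at most a multiple of the mean of `l * log (1 / l) ≤ 2 * √l`, where `l` is the length of
the cell in the walk killed above `1`. By strict convexity `√N - √l` is a bounded function that
decreases in mean by a multiple of `√l`, so the total loss is bounded, uniformly in the starting
depth (`sum_walkOp_sqrt_le`). Started deep enough, the mean depth on survival therefore stays above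
`1` forever, whereas the depth at time `t` is `O(t)`: the survival probability at time `t` is at
least a multiple of `1 / t`, and its sum over `t` diverges.

The passage from means to almost sure frequencies is a strong law for bounded martingale
differences (`ae_eventually_sum_le`), applied to bounded functions of the cell.
-/

/-! ### Cells and the killed motion -/

namespace TwoPoint

/-- A half-open interval `[left, left + len)` of positive length contained in `[0,1)`. -/
structure Cell where
  /-- The left endpoint. -/
  left : ℝ
  /-- The length. -/
  len : ℝ
  left_nonneg : 0 ≤ left
  len_pos : 0 < len
  add_le_one : left + len ≤ 1

namespace Cell

/-- The point `x` lies in the cell `c`. -/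
def Contains (c : Cell) (x : ℝ) : Prop := c.left ≤ x ∧ x < c.left + c.len

/-- The whole interval `[0,1)`. -/
def root : Cell := ⟨0, 1, le_rfl, one_pos, by norm_num⟩

theorem len_le_one (c : Cell) : c.len ≤ 1 := by linarith [c.left_nonneg, c.add_le_one]

/-- The image of a cell under the contraction `x ↦ (x + j) / M`, which is `f_{j+1}`. -/
noncomputable def contract {M : ℕ} (c : Cell) (j : Fin M) : Cell where
  left := (c.left + (j : ℕ)) / M
  len := c.len / M
  left_nonneg := by have := c.left_nonneg; positivity
  len_pos := by
    have := c.len_pos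
    have : (0 : ℝ) < M := by exact_mod_cast j.pos
    positivity
  add_le_one := by
    have hM : (0 : ℝ) < M := by exact_mod_cast j.pos
    have hj : ((j : ℕ) : ℝ) + 1 ≤ M := by exact_mod_cast j.isLt
    rw [← add_div, div_le_one hM]
    linarith [c.add_le_one]

/-- The cell is cut by the `N`-adic map: some `k / N` with `1 ≤ k ≤ N - 1` lies in its interior.
Equivalently, the affine image that starts at `Int.fract (N * left)` reaches beyond `1`. -/
def Cut (N : ℕ) (c : Cell) : Prop := 1 < Int.fract (N * c.left) + N * c.len

/-- The image under the `N`-adic map of a cell that is not cut. -/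
noncomputable def expand (N : ℕ) [NeZero N] (c : Cell) (h : ¬ c.Cut N) : Cell where
  left := Int.fract (N * c.left)
  len := N * c.len
  left_nonneg := Int.fract_nonneg _
  len_pos := by
    have : (0 : ℝ) < N := by exact_mod_cast Nat.pos_of_ne_zero (NeZero.ne N)
    have := c.len_pos
    positivity
  add_le_one := not_lt.1 h

theorem exists_contains_of_cut {N : ℕ} [NeZero N] {c : Cell} (h : c.Cut N) :
    ∃ k ∈ Finset.range N, c.Contains ((k : ℝ) / N) := by
  have hN : (0 : ℝ) < N := by exact_mod_cast Nat.pos_of_ne_zero (NeZero.ne N)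
  have h0 : 0 ≤ (N : ℝ) * c.left := mul_nonneg hN.le c.left_nonneg
  have hf : (⌊(N : ℝ) * c.left⌋₊ : ℝ) + Int.fract ((N : ℝ) * c.left) = N * c.left := by
    rw [natCast_floor_eq_intCast_floor h0]; exact Int.floor_add_fract _
  have h1 := Int.fract_lt_one ((N : ℝ) * c.left)
  unfold Cut at h
  have h2 : (⌊(N : ℝ) * c.left⌋₊ : ℝ) + 1 < N * (c.left + c.len) := by linarith
  refine ⟨⌊(N : ℝ) * c.left⌋₊ + 1, ?_, ?_, ?_⟩
  · rw [Finset.mem_range]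
    have : (⌊(N : ℝ) * c.left⌋₊ : ℝ) + 1 < N := by nlinarith [c.add_le_one]
    exact_mod_cast this
  · rw [le_div_iff₀ hN]; push_cast; linarith
  · rw [div_lt_iff₀ hN]; push_cast; linarith

theorem exists_contains_of_expand {N : ℕ} [NeZero N] {c : Cell} (h : ¬ c.Cut N) {x : ℝ}
    (hx : (c.expand N h).Contains x) : ∃ k ∈ Finset.range N, c.Contains ((x + k) / N) := by
  have hN : (0 : ℝ) < N := by exact_mod_cast Nat.pos_of_ne_zero (NeZero.ne N)
  have h0 : 0 ≤ (N : ℝ) * c.left := mul_nonneg hN.le c.left_nonneg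
  have hf : (⌊(N : ℝ) * c.left⌋₊ : ℝ) + Int.fract ((N : ℝ) * c.left) = N * c.left := by
    rw [natCast_floor_eq_intCast_floor h0]; exact Int.floor_add_fract _
  have h1 := Int.fract_nonneg ((N : ℝ) * c.left)
  obtain ⟨hx1, hx2⟩ := hx
  simp only [expand] at hx1 hx2
  refine ⟨⌊(N : ℝ) * c.left⌋₊, ?_, ?_, ?_⟩
  · rw [Finset.mem_range]
    have : (⌊(N : ℝ) * c.left⌋₊ : ℝ) < N := by nlinarith [c.add_le_one, c.len_pos]
    exact_mod_cast this
  · rw [le_div_iff₀ hN]; linarith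
  · rw [div_lt_iff₀ hN]; linarith

theorem contains_of_contract {M : ℕ} {c : Cell} {j : Fin M} {x : ℝ}
    (hx : (c.contract j).Contains x) :
    ⌊(M : ℝ) * x⌋ = (j : ℕ) ∧ c.Contains (Int.fract ((M : ℝ) * x)) := by
  have hM : (0 : ℝ) < M := by exact_mod_cast j.pos
  obtain ⟨hx1, hx2⟩ := hx
  simp only [contract] at hx1 hx2
  rw [← add_div, lt_div_iff₀ hM] at hx2
  rw [div_le_iff₀ hM] at hx1
  have h0 := c.left_nonneg
  have h1 := c.add_le_one
  have hfl : ⌊(M : ℝ) * x⌋ = ((j : ℕ) : ℤ) := by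
    rw [Int.floor_eq_iff]; push_cast; constructor <;> linarith
  refine ⟨hfl, ?_⟩
  rw [Contains, Int.fract, hfl]
  push_cast
  constructor <;> linarith

/-- The depth `-log len`; a contraction raises it by `log M`, an expansion lowers it by `log N`. -/
noncomputable def depth (c : Cell) : ℝ := -Real.log c.len

theorem depth_root : root.depth = 0 := by simp [depth, root]

theorem depth_contract {M : ℕ} (c : Cell) (j : Fin M) :
    (c.contract j).depth = c.depth + Real.log M := by
  have hM : (M : ℝ) ≠ 0 := by exact_mod_cast j.pos.ne'
  simp only [depth, contract, Real.log_div c.len_pos.ne' hM]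
  ring

theorem depth_expand {N : ℕ} [NeZero N] (c : Cell) (h : ¬ c.Cut N) :
    (c.expand N h).depth = c.depth - Real.log N := by
  have hN : (N : ℝ) ≠ 0 := by exact_mod_cast NeZero.ne N
  simp only [depth, expand, Real.log_mul hN c.len_pos.ne']
  ring

theorem depth_le (c : Cell) : c.depth ≤ 2 / √c.len := by
  have hs : 0 < √c.len := Real.sqrt_pos.2 c.len_pos
  have h1 := Real.log_le_sub_one_of_pos (inv_pos.2 hs)
  rw [Real.log_inv, Real.log_sqrt c.len_pos.le] at h1
  rw [depth, div_eq_mul_inv]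
  linarith

end Cell

open Cell

open Classical in
/-- The observable `φ (len c)` restricted to the cells that contain `x`. -/
noncomputable def cellsAt (x : ℝ) (φ : ℝ → ℝ) (c : Cell) : ℝ := if c.Contains x then φ c.len else 0

theorem cellsAt_nonneg (x : ℝ) {φ : ℝ → ℝ} (hφ : ∀ l, 0 ≤ φ l) (c : Cell) : 0 ≤ cellsAt x φ c := by
  unfold cellsAt; split_ifs
  exacts [hφ _, le_rfl]

/-- The transition operator of a contraction chosen uniformly among `f_1, …, f_M`. -/
noncomputable def contractOp (M : ℕ) : Module.End ℝ (Cell → ℝ) where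
  toFun F c := (∑ j : Fin M, F (c.contract j)) / M
  map_add' F G := by
    ext c; simp [Finset.sum_add_distrib, add_div]
  map_smul' r F := by
    ext c; simp [← Finset.mul_sum, mul_div_assoc]

open Classical in
/-- The transition operator of the `N`-adic map, where a cell that is cut is killed. -/
noncomputable def expandOp (N : ℕ) [NeZero N] : Module.End ℝ (Cell → ℝ) where
  toFun F c := if h : c.Cut N then 0 else F (c.expand N h)
  map_add' F G := by
    ext c; by_cases h : c.Cut N <;> simp [h]
  map_smul' r F := by
    ext c; by_cases h : c.Cut N <;> simp [h]

/-- The transition operator of the random motion of cells, killed when the cell is cut. -/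
noncomputable def killedOp (M N : ℕ) [NeZero N] (p₀ : ℝ) : Module.End ℝ (Cell → ℝ) :=
  (1 - p₀) • contractOp M + p₀ • expandOp N

section operators

variable {M N : ℕ} [NeZero N] {p₀ : ℝ}

theorem killedOp_apply (F : Cell → ℝ) (c : Cell) :
    killedOp M N p₀ F c = (1 - p₀) * contractOp M F c + p₀ * expandOp N F c := rfl

theorem contractOp_mono : Monotone (contractOp M) := by
  intro F G h c
  simp only [contractOp, LinearMap.coe_mk, AddHom.coe_mk]
  gcongr with j
  exact h _

theorem expandOp_mono : Monotone (expandOp N) := by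
  intro F G h c
  simp only [expandOp, LinearMap.coe_mk, AddHom.coe_mk]
  split_ifs
  exacts [le_rfl, h _]

theorem killedOp_mono (h0 : 0 < p₀) (h1 : p₀ < 1) : Monotone (killedOp M N p₀) := by
  intro F G h c
  rw [killedOp_apply, killedOp_apply]
  have h2 : 0 ≤ 1 - p₀ := by linarith
  gcongr
  · exact contractOp_mono h c
  · exact expandOp_mono h c

theorem pow_mono {A : Module.End ℝ (Cell → ℝ)} (hA : Monotone A) (n : ℕ) : Monotone ⇑(A ^ n) := by
  rw [Module.End.coe_pow]
  exact hA.iterate n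

theorem contractOp_const (hM : 2 ≤ M) (r : ℝ) (c : Cell) : contractOp M (fun _ => r) c = r := by
  have : (M : ℝ) ≠ 0 := by positivity
  simp [contractOp]
  field_simp

theorem contractOp_cellsAt_le (x : ℝ) {φ : ℝ → ℝ} (hφ : ∀ l, 0 ≤ φ l) :
    contractOp M (cellsAt x φ) ≤
      (1 / (M : ℝ)) • cellsAt (Int.fract ((M : ℝ) * x)) (fun l => φ (l / M)) := by
  intro c
  simp only [contractOp, LinearMap.coe_mk, AddHom.coe_mk, Pi.smul_apply, smul_eq_mul]
  rw [div_eq_mul_one_div, mul_comm]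
  gcongr
  by_cases h : ∃ j : Fin M, (c.contract j).Contains x
  · obtain ⟨j, hj⟩ := h
    obtain ⟨h1, h2⟩ := contains_of_contract hj
    rw [Finset.sum_eq_single j]
    · rw [cellsAt, if_pos hj, cellsAt, if_pos h2]; rfl
    · intro i _ hi
      rw [cellsAt, if_neg]
      intro hi'
      have h3 := (contains_of_contract hi').1
      rw [h1] at h3
      exact hi (Fin.ext (by exact_mod_cast h3.symm))
    · simp
  · push Not at h
    rw [Finset.sum_eq_zero]
    · exact cellsAt_nonneg _ (fun l => hφ _) c
    · intro j _
      simp [cellsAt, h j]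

theorem expandOp_cellsAt_le (x : ℝ) {φ : ℝ → ℝ} (hφ : ∀ l, 0 ≤ φ l) :
    expandOp N (cellsAt x φ) ≤
      ∑ k ∈ Finset.range N,
        cellsAt ((x + k) / N) (fun l => if (N : ℝ) * l ≤ 1 then φ (N * l) else 0) := by
  intro c
  have hφ' : ∀ l, 0 ≤ (if (N : ℝ) * l ≤ 1 then φ (N * l) else 0) := by
    intro l; split_ifs
    exacts [hφ _, le_rfl]
  simp only [expandOp, LinearMap.coe_mk, AddHom.coe_mk, Finset.sum_apply]
  have hs : ∀ k ∈ Finset.range N, 0 ≤ cellsAt ((x + k) / N)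
      (fun l => if (N : ℝ) * l ≤ 1 then φ (N * l) else 0) c := fun k _ => cellsAt_nonneg _ hφ' c
  split_ifs with h
  · exact Finset.sum_nonneg hs
  · by_cases hx : (c.expand N h).Contains x
    · obtain ⟨k, hk, hc⟩ := exists_contains_of_expand h hx
      refine le_trans (le_of_eq ?_) (Finset.single_le_sum hs hk)
      have : (N : ℝ) * c.len ≤ 1 := (c.expand N h).len_le_one
      rw [cellsAt, if_pos hx, cellsAt, if_pos hc, if_pos this]; rfl
    · rw [cellsAt, if_neg hx]
      exact Finset.sum_nonneg hs

theorem contractOp_pow_cellsAt_le (H : ℕ) (x : ℝ) (φ : ℝ → ℝ) (hφ : ∀ l, 0 ≤ φ l) (c : Cell) :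
    (contractOp M ^ H) (cellsAt x φ) c ≤ (1 / (M : ℝ) ^ H) * φ (c.len / (M : ℝ) ^ H) := by
  induction H generalizing x φ with
  | zero =>
    simp only [pow_zero, Module.End.one_apply, div_one, one_mul, cellsAt]
    split_ifs
    exacts [le_rfl, hφ _]
  | succ H ih =>
    rw [pow_succ, Module.End.mul_apply]
    refine (pow_mono contractOp_mono H (contractOp_cellsAt_le x hφ) c).trans ?_
    rw [map_smul, Pi.smul_apply, smul_eq_mul]
    refine (mul_le_mul_of_nonneg_left (ih _ _ (fun l => hφ _)) (by positivity)).trans (le_of_eq ?_)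
    rw [div_div, ← pow_succ, ← mul_assoc, pow_succ]
    congr 1
    rw [one_div_mul_one_div, mul_comm]

end operators

/-! ### The walk of the lengths -/

/-- The transition operator of the walk of the lengths: `l ↦ l / M` with probability `1 - p₀` and
`l ↦ N l` with probability `p₀`, killed when the length exceeds `1`. -/
noncomputable def walkOp (M N : ℕ) (p₀ : ℝ) : Module.End ℝ (ℝ → ℝ) where
  toFun φ l := (1 - p₀) * φ (l / M) + p₀ * (if (N : ℝ) * l ≤ 1 then φ (N * l) else 0)
  map_add' φ ψ := by
    ext l; by_cases h : (N : ℝ) * l ≤ 1 <;> simp [h] <;> ring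
  map_smul' r φ := by
    ext l; by_cases h : (N : ℝ) * l ≤ 1 <;> simp [h] <;> ring

section walk

variable {M N : ℕ} {p₀ : ℝ}

theorem walkOp_apply (φ : ℝ → ℝ) (l : ℝ) : walkOp M N p₀ φ l =
    (1 - p₀) * φ (l / M) + p₀ * (if (N : ℝ) * l ≤ 1 then φ (N * l) else 0) := rfl

theorem walkOp_mono (hM : 2 ≤ M) (hN : 2 ≤ N) (h0 : 0 < p₀) (h1 : p₀ < 1) {φ ψ : ℝ → ℝ}
    (h : ∀ l, 0 < l → l ≤ 1 → φ l ≤ ψ l) (l : ℝ) (hl : 0 < l) (hl1 : l ≤ 1) :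
    walkOp M N p₀ φ l ≤ walkOp M N p₀ ψ l := by
  have hM' : (2 : ℝ) ≤ M := by exact_mod_cast hM
  have h2 : 0 ≤ 1 - p₀ := by linarith
  rw [walkOp_apply, walkOp_apply]
  gcongr
  · refine h _ (by positivity) ?_
    rw [div_le_one (by positivity)]
    linarith
  · split_ifs with h3
    · exact h _ (by positivity) h3
    · exact le_rfl

theorem walkOp_pow_mono (hM : 2 ≤ M) (hN : 2 ≤ N) (h0 : 0 < p₀) (h1 : p₀ < 1) (t : ℕ)
    {φ ψ : ℝ → ℝ} (h : ∀ l, 0 < l → l ≤ 1 → φ l ≤ ψ l) (l : ℝ) (hl : 0 < l) (hl1 : l ≤ 1) :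
    (walkOp M N p₀ ^ t) φ l ≤ (walkOp M N p₀ ^ t) ψ l := by
  induction t generalizing φ ψ with
  | zero => exact h l hl hl1
  | succ t ih =>
    rw [pow_succ, Module.End.mul_apply, Module.End.mul_apply]
    exact ih (walkOp_mono hM hN h0 h1 h)

/-- The mean of `√(l'/l)` over one step of the walk of the lengths. -/
noncomputable def sqrtGrowth (M N : ℕ) (p₀ : ℝ) : ℝ := p₀ * √N + (1 - p₀) / √M

/-- Strict convexity: the mean of the logarithm is `L_{p₀} / 2 = 0`, so the mean exceeds `1`. -/
theorem one_lt_sqrtGrowth (hM : 2 ≤ M) (hN : 2 ≤ N) (h0 : 0 < p₀) (h1 : p₀ < 1)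
    (hL : lyapunov M N p₀ = 0) : 1 < sqrtGrowth M N p₀ := by
  have hM' : (0 : ℝ) < M := by positivity
  have hN' : (0 : ℝ) < N := by positivity
  have hlog : 0 < Real.log N := Real.log_pos (by exact_mod_cast hN)
  have e1 : √(N : ℝ) = Real.exp (Real.log N / 2) := by
    rw [← Real.log_sqrt hN'.le, Real.exp_log (Real.sqrt_pos.2 hN')]
  have e2 : (√(M : ℝ))⁻¹ = Real.exp (-(Real.log M / 2)) := by
    rw [← Real.log_sqrt hM'.le, Real.exp_neg, Real.exp_log (Real.sqrt_pos.2 hM')]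
  have i1 := Real.add_one_lt_exp (x := Real.log N / 2) (by positivity)
  have i2 := Real.add_one_le_exp (-(Real.log M / 2))
  rw [lyapunov] at hL
  rw [sqrtGrowth, div_eq_mul_inv, e1, e2]
  have j1 := mul_lt_mul_of_pos_left i1 h0
  have j2 := mul_le_mul_of_nonneg_left i2 (by linarith : 0 ≤ 1 - p₀)
  linarith

/-- The potential of the square root along the killed walk is bounded uniformly in the starting
length, because `√N - √l` is nonnegative and decreases in mean by a multiple of `√l`. -/
theorem sum_walkOp_sqrt_le (hM : 2 ≤ M) (hN : 2 ≤ N) (h0 : 0 < p₀) (h1 : p₀ < 1)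
    (hL : lyapunov M N p₀ = 0) (t : ℕ) (l : ℝ) (hl : 0 < l) (hl1 : l ≤ 1) :
    ∑ s ∈ Finset.range t, (walkOp M N p₀ ^ s) (fun l => √l) l ≤
      √N / (sqrtGrowth M N p₀ - 1) := by
  have hκ := one_lt_sqrtGrowth hM hN h0 h1 hL
  set κ := sqrtGrowth M N p₀ with hκd
  set χ : ℝ → ℝ := fun l => √N - √l with hχ
  have hN1 : 1 ≤ √(N : ℝ) := by
    rw [Real.one_le_sqrt]; exact_mod_cast (by omega : 1 ≤ N)
  have hstep : ∀ l, 0 < l → l ≤ 1 →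
      walkOp M N p₀ χ l ≤ (χ - (κ - 1) • fun l => √l) l := by
    intro l hl hl1
    have hd : (if (N : ℝ) * l ≤ 1 then χ (N * l) else 0) ≤ √N - √N * √l := by
      have : 0 ≤ √(N : ℝ) - √N * √l := by
        have : √l ≤ 1 := Real.sqrt_le_iff.2 ⟨zero_le_one, by simpa using hl1⟩
        nlinarith
      split_ifs
      · rw [hχ]; simp only [Real.sqrt_mul (Nat.cast_nonneg N)]; exact le_rfl
      · exact this
    have := mul_le_mul_of_nonneg_left hd h0.le
    rw [walkOp_apply]
    simp only [hχ, Real.sqrt_div hl.le, Pi.sub_apply, Pi.smul_apply, smul_eq_mul] at this ⊢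
    rw [hκd, sqrtGrowth]
    have e : (1 - p₀) * (√N - √l / √M) = (1 - p₀) * √N - (1 - p₀) / √M * √l := by ring
    rw [e]
    linarith
  have key : ∀ t, (walkOp M N p₀ ^ t) χ l +
      (κ - 1) * ∑ s ∈ Finset.range t, (walkOp M N p₀ ^ s) (fun l => √l) l ≤ χ l := by
    intro t
    induction t with
    | zero => simp
    | succ t ih =>
      have := walkOp_pow_mono hM hN h0 h1 t hstep l hl hl1
      rw [map_sub, map_smul, Pi.sub_apply, Pi.smul_apply, smul_eq_mul] at this
      rw [pow_succ, Module.End.mul_apply, Finset.sum_range_succ, mul_add]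
      linarith
  have hpos : 0 ≤ (walkOp M N p₀ ^ t) χ l := by
    have := walkOp_pow_mono hM hN h0 h1 t (φ := 0) (ψ := χ) (fun l _ hl1 => by
      have : √l ≤ 1 := Real.sqrt_le_iff.2 ⟨zero_le_one, by simpa using hl1⟩
      simp only [hχ, Pi.zero_apply]; linarith) l hl hl1
    simpa using this
  rw [le_div_iff₀ (by linarith), mul_comm]
  have := key t
  have h3 : χ l ≤ √N := by simp only [hχ]; linarith [Real.sqrt_nonneg l]
  linarith

end walk

/-! ### The mean lifetime of a cell is infinite -/

section survival

variable {M N : ℕ} [NeZero N] {p₀ : ℝ}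

/-- The mean of an observable after `t` steps of the killed motion, started from the cell
`[j / M ^ H, (j + 1) / M ^ H)` with `j` uniform in `{0, …, M ^ H - 1}`. -/
noncomputable def cellMean (M N : ℕ) [NeZero N] (p₀ : ℝ) (H t : ℕ) : (Cell → ℝ) →ₗ[ℝ] ℝ :=
  LinearMap.proj root ∘ₗ (contractOp M ^ H * killedOp M N p₀ ^ t)

theorem cellMean_apply (H t : ℕ) (F : Cell → ℝ) : cellMean M N p₀ H t F =
    (contractOp M ^ H) ((killedOp M N p₀ ^ t) F) root := rfl

theorem cellMean_succ (H t : ℕ) (F : Cell → ℝ) :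
    cellMean M N p₀ H (t + 1) F = cellMean M N p₀ H t (killedOp M N p₀ F) := by
  rw [cellMean_apply, cellMean_apply, pow_succ (killedOp M N p₀), Module.End.mul_apply]

theorem cellMean_mono (h0 : 0 < p₀) (h1 : p₀ < 1) (H t : ℕ) : Monotone (cellMean M N p₀ H t) :=
  fun _ _ h => pow_mono contractOp_mono H (pow_mono (killedOp_mono h0 h1) t h) root

/-- All the maps preserve Lebesgue measure in mean, so the cells that have been followed so far
cover each point `x` with density at most one: the mean over the cells that contain `x` is at most
the mean, over the walk of the lengths, of the length. -/
theorem cellMean_cellsAt_le (hM : 2 ≤ M) (h0 : 0 < p₀) (h1 : p₀ < 1) (H t : ℕ)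
    (x : ℝ) (φ : ℝ → ℝ) (hφ : ∀ l, 0 ≤ φ l) :
    cellMean M N p₀ H t (cellsAt x φ) ≤
      (walkOp M N p₀ ^ t) (fun l => l * φ l) (1 / (M : ℝ) ^ H) := by
  have hM' : (M : ℝ) ≠ 0 := by positivity
  have hN' : (N : ℝ) ≠ 0 := by exact_mod_cast NeZero.ne N
  induction t generalizing x φ with
  | zero => exact contractOp_pow_cellsAt_le H x φ hφ root
  | succ t ih =>
    have h2 : 0 ≤ 1 - p₀ := by linarith
    set φM : ℝ → ℝ := fun l => φ (l / M) with hφM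
    set φN : ℝ → ℝ := fun l => if (N : ℝ) * l ≤ 1 then φ (N * l) else 0 with hφN
    have hφN0 : ∀ l, 0 ≤ φN l := by
      intro l
      simp only [hφN]
      split_ifs
      exacts [hφ _, le_rfl]
    have hle : killedOp M N p₀ (cellsAt x φ) ≤
        (1 - p₀) • ((1 / (M : ℝ)) • cellsAt (Int.fract ((M : ℝ) * x)) φM) +
          p₀ • ∑ k ∈ Finset.range N, cellsAt ((x + k) / N) φN := by
      intro c
      rw [killedOp_apply, Pi.add_apply, Pi.smul_apply, Pi.smul_apply, smul_eq_mul, smul_eq_mul]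
      exact add_le_add (mul_le_mul_of_nonneg_left (contractOp_cellsAt_le x hφ c) h2)
        (mul_le_mul_of_nonneg_left (expandOp_cellsAt_le x hφ c) h0.le)
    have hW : walkOp M N p₀ (fun l => l * φ l) =
        (1 - p₀) • ((1 / (M : ℝ)) • fun l => l * φM l) +
          p₀ • ((N : ℝ) • fun l => l * φN l) := by
      ext l
      simp only [walkOp_apply, Pi.add_apply, Pi.smul_apply, smul_eq_mul, hφM, hφN]
      split_ifs <;> ring
    rw [cellMean_succ, pow_succ, Module.End.mul_apply, hW]
    refine (cellMean_mono h0 h1 H t hle).trans ?_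
    simp only [map_add, map_smul, map_sum, Pi.add_apply, Pi.smul_apply, smul_eq_mul]
    refine add_le_add (mul_le_mul_of_nonneg_left (mul_le_mul_of_nonneg_left
      (ih _ _ (fun l => hφ _)) (by positivity)) h2) (mul_le_mul_of_nonneg_left ?_ h0.le)
    calc ∑ k ∈ Finset.range N, cellMean M N p₀ H t (cellsAt ((x + k) / N) φN)
        ≤ ∑ _k ∈ Finset.range N,
            (walkOp M N p₀ ^ t) (fun l => l * φN l) (1 / (M : ℝ) ^ H) :=
          Finset.sum_le_sum (fun k _ => ih _ _ hφN0)
      _ = N * (walkOp M N p₀ ^ t) (fun l => l * φN l) (1 / (M : ℝ) ^ H) := by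
          rw [Finset.sum_const, Finset.card_range, nsmul_eq_mul]

open Classical in
/-- The depth, restricted to the cells that the `N`-adic map cuts. -/
noncomputable def cutDepth (N : ℕ) (c : Cell) : ℝ := if c.Cut N then c.depth else 0

theorem cutDepth_le :
    cutDepth N ≤ ∑ k ∈ Finset.range N, cellsAt ((k : ℝ) / N) (fun l => 2 / √l) := by
  intro c
  have hφ : ∀ l : ℝ, 0 ≤ 2 / √l := fun l => by positivity
  rw [Finset.sum_apply]
  have hs : ∀ k ∈ Finset.range N, 0 ≤ cellsAt ((k : ℝ) / N) (fun l => 2 / √l) c :=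
    fun k _ => cellsAt_nonneg _ hφ c
  unfold cutDepth
  split_ifs with h
  · obtain ⟨k, hk, hc⟩ := exists_contains_of_cut h
    refine le_trans ?_ (Finset.single_le_sum hs hk)
    rw [cellsAt, if_pos hc]
    exact c.depth_le
  · exact Finset.sum_nonneg hs

theorem cellMean_cutDepth_le (hM : 2 ≤ M) (h0 : 0 < p₀) (h1 : p₀ < 1) (H t : ℕ) :
    cellMean M N p₀ H t (cutDepth N) ≤
      N * (2 * (walkOp M N p₀ ^ t) (fun l => √l) (1 / (M : ℝ) ^ H)) := by
  have hφ : ∀ l : ℝ, 0 ≤ 2 / √l := fun l => by positivity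
  refine (cellMean_mono h0 h1 H t cutDepth_le).trans ?_
  rw [map_sum]
  have e : (fun l : ℝ => l * (2 / √l)) = (2 : ℝ) • fun l => √l := by
    ext l
    rw [mul_div_left_comm, Real.div_sqrt]
    rfl
  calc ∑ k ∈ Finset.range N, cellMean M N p₀ H t (cellsAt ((k : ℝ) / N) (fun l => 2 / √l))
      ≤ ∑ _k ∈ Finset.range N,
          (walkOp M N p₀ ^ t) (fun l => l * (2 / √l)) (1 / (M : ℝ) ^ H) :=
        Finset.sum_le_sum (fun k _ => cellMean_cellsAt_le hM h0 h1 H t _ _ hφ)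
    _ = _ := by
        rw [Finset.sum_const, Finset.card_range, nsmul_eq_mul, e, map_smul]
        rfl

/-- As the Lyapunov exponent vanishes, the depth loses mean only through the cells that are cut. -/
theorem le_killedOp_depth (hM : 2 ≤ M) (hN : 2 ≤ N) (h0 : 0 < p₀) (hL : lyapunov M N p₀ = 0) :
    depth - p₀ • cutDepth N ≤ killedOp M N p₀ depth := by
  intro c
  have hM' : (M : ℝ) ≠ 0 := by positivity
  have hlog : 0 ≤ Real.log N := Real.log_nonneg (by exact_mod_cast (by omega : 1 ≤ N))
  have hC : contractOp M depth c = c.depth + Real.log M := by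
    simp only [contractOp, LinearMap.coe_mk, AddHom.coe_mk, depth_contract, Finset.sum_const,
      Finset.card_univ, Fintype.card_fin, nsmul_eq_mul]
    field_simp
  have hE : c.depth - cutDepth N c - Real.log N ≤ expandOp N depth c := by
    simp only [expandOp, LinearMap.coe_mk, AddHom.coe_mk, cutDepth]
    split_ifs with h
    · linarith
    · rw [depth_expand]; linarith
  have := mul_le_mul_of_nonneg_left hE h0.le
  rw [lyapunov] at hL
  rw [killedOp_apply, hC, Pi.sub_apply, Pi.smul_apply, smul_eq_mul]
  linarith

theorem contractOp_pow_depth (hM : 2 ≤ M) (H : ℕ) :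
    (contractOp M ^ H) depth root = H * Real.log M := by
  have hM' : (M : ℝ) ≠ 0 := by positivity
  have key : ∀ c, (contractOp M ^ H) depth c = c.depth + H * Real.log M := by
    induction H with
    | zero => simp
    | succ H ih =>
      intro c
      rw [pow_succ', Module.End.mul_apply]
      simp only [contractOp, LinearMap.coe_mk, AddHom.coe_mk] at ih ⊢
      simp only [ih, depth_contract, Finset.sum_const, Finset.card_univ,
        Fintype.card_fin, nsmul_eq_mul]
      push_cast
      field_simp
      ring
  rw [key, depth_root, zero_add]

/-- Started deep enough, the killed motion keeps a mean depth of at least `1` forever. -/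
theorem exists_one_le_cellMean_depth (hM : 2 ≤ M) (hN : 2 ≤ N) (h0 : 0 < p₀) (h1 : p₀ < 1)
    (hL : lyapunov M N p₀ = 0) : ∃ H : ℕ, ∀ t, 1 ≤ cellMean M N p₀ H t depth := by
  have hlog : 0 < Real.log M := Real.log_pos (by exact_mod_cast hM)
  set C : ℝ := p₀ * (N * (2 * (√N / (sqrtGrowth M N p₀ - 1)))) with hC
  obtain ⟨H, hH⟩ := exists_nat_ge ((C + 1) / Real.log M)
  rw [div_le_iff₀ hlog] at hH
  refine ⟨H, fun t => ?_⟩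
  have hM1 : (1 : ℝ) ≤ (M : ℝ) ^ H :=
    one_le_pow₀ (by exact_mod_cast (by omega : 1 ≤ M))
  have key : H * Real.log M - p₀ * ∑ s ∈ Finset.range t, cellMean M N p₀ H s (cutDepth N) ≤
      cellMean M N p₀ H t depth := by
    induction t with
    | zero => simp [cellMean_apply, contractOp_pow_depth hM]
    | succ t ih =>
      have := cellMean_mono (M := M) (N := N) h0 h1 H t (le_killedOp_depth hM hN h0 hL)
      rw [map_sub, map_smul, smul_eq_mul] at this
      rw [cellMean_succ, Finset.sum_range_succ, mul_add]
      linarith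
  have hsum : ∑ s ∈ Finset.range t, cellMean M N p₀ H s (cutDepth N) ≤
      N * (2 * (√N / (sqrtGrowth M N p₀ - 1))) := by
    refine (Finset.sum_le_sum (fun s _ => cellMean_cutDepth_le hM h0 h1 H s)).trans ?_
    rw [← Finset.mul_sum, ← Finset.mul_sum]
    gcongr
    exact sum_walkOp_sqrt_le hM hN h0 h1 hL t _ (by positivity)
      (by rw [div_le_one (by positivity)]; exact hM1)
  have := mul_le_mul_of_nonneg_left hsum h0.le
  linarith

theorem contractOp_pow_depth_mul (H : ℕ) (r : ℝ) (F : Cell → ℝ) (c : Cell) :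
    (contractOp M ^ H) (fun c => (c.depth + r) * F c) c =
      (c.depth + r + H * Real.log M) * (contractOp M ^ H) F c := by
  induction H generalizing c with
  | zero => simp
  | succ H ih =>
    rw [pow_succ', Module.End.mul_apply, Module.End.mul_apply]
    simp only [contractOp, LinearMap.coe_mk, AddHom.coe_mk] at ih ⊢
    simp only [ih, depth_contract]
    rw [← mul_div_assoc, Finset.mul_sum]
    congr 1
    refine Finset.sum_congr rfl (fun j _ => ?_)
    push_cast
    ring

theorem expandOp_depth_mul_le (hM : 2 ≤ M) (r : ℝ) {F : Cell → ℝ} (hF : 0 ≤ F) (c : Cell) :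
    expandOp N (fun c => (c.depth + r) * F c) c ≤
      (c.depth + r + Real.log M) * expandOp N F c := by
  have hlM : 0 ≤ Real.log M := Real.log_nonneg (by exact_mod_cast (by omega : 1 ≤ M))
  have hlN : 0 ≤ Real.log N :=
    Real.log_nonneg (by exact_mod_cast Nat.pos_of_ne_zero (NeZero.ne N))
  simp only [expandOp, LinearMap.coe_mk, AddHom.coe_mk]
  split_ifs with h
  · simp
  · rw [depth_expand]
    exact mul_le_mul_of_nonneg_right (by linarith) (hF _)

theorem killedOp_pow_one_nonneg (h0 : 0 < p₀) (h1 : p₀ < 1) (t : ℕ) :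
    0 ≤ (killedOp M N p₀ ^ t) 1 := by
  have := pow_mono (killedOp_mono (M := M) (N := N) h0 h1) t (zero_le_one : (0 : Cell → ℝ) ≤ 1)
  rwa [map_zero] at this

theorem killedOp_pow_one_le (hM : 2 ≤ M) (h0 : 0 < p₀) (h1 : p₀ < 1) (t : ℕ) :
    (killedOp M N p₀ ^ t) 1 ≤ 1 := by
  have hstep : killedOp M N p₀ 1 ≤ 1 := by
    intro c
    have hC : contractOp M 1 c = 1 := contractOp_const hM 1 c
    have hE : expandOp N 1 c ≤ 1 := by
      simp only [expandOp, LinearMap.coe_mk, AddHom.coe_mk]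
      split_ifs <;> simp
    have := mul_le_mul_of_nonneg_left hE h0.le
    rw [killedOp_apply, hC, Pi.one_apply]
    linarith
  induction t with
  | zero => simp
  | succ t ih =>
    rw [pow_succ, Module.End.mul_apply]
    exact (pow_mono (killedOp_mono h0 h1) t hstep).trans ih

/-- The depth grows at most linearly in time, on the event of survival. -/
theorem killedOp_pow_depth_le (hM : 2 ≤ M) (h0 : 0 < p₀) (h1 : p₀ < 1) (t : ℕ) :
    (killedOp M N p₀ ^ t) depth ≤
      fun c => (c.depth + t * Real.log M) * (killedOp M N p₀ ^ t) 1 c := by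
  induction t with
  | zero => intro c; simp
  | succ t ih =>
    have h2 : 0 ≤ 1 - p₀ := by linarith
    intro c
    rw [pow_succ', Module.End.mul_apply, Module.End.mul_apply]
    refine (killedOp_mono h0 h1 ih c).trans ?_
    have hC := contractOp_pow_depth_mul (M := M) 1 (t * Real.log M) ((killedOp M N p₀ ^ t) 1) c
    have hE := mul_le_mul_of_nonneg_left (expandOp_depth_mul_le (N := N) hM (t * Real.log M)
      (killedOp_pow_one_nonneg (M := M) (N := N) h0 h1 t) c) h0.le
    rw [pow_one] at hC
    simp only [killedOp_apply, hC]
    push_cast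
    linarith

theorem contractOp_pow_le_killedOp_pow (h0 : 0 < p₀) (h1 : p₀ < 1) (H : ℕ) {F : Cell → ℝ}
    (hF : 0 ≤ F) : (1 - p₀) ^ H • (contractOp M ^ H) F ≤ (killedOp M N p₀ ^ H) F := by
  induction H with
  | zero => simp
  | succ H ih =>
    have hC : 0 ≤ (contractOp M ^ H) F := by
      have := pow_mono (contractOp_mono (M := M)) H hF
      rwa [map_zero] at this
    have hE : 0 ≤ expandOp N ((contractOp M ^ H) F) := by
      have := expandOp_mono (N := N) hC
      rwa [map_zero] at this
    have h2 : 0 ≤ (1 - p₀) ^ H := pow_nonneg (by linarith) H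
    intro c
    have h3 := killedOp_mono (M := M) (N := N) h0 h1 ih c
    have h4 := mul_nonneg h2 (mul_nonneg h0.le (hE c))
    rw [map_smul, Pi.smul_apply, smul_eq_mul, killedOp_apply] at h3
    rw [pow_succ' (killedOp M N p₀), pow_succ' (contractOp M), Module.End.mul_apply,
      Module.End.mul_apply, Pi.smul_apply, smul_eq_mul]
    refine le_trans ?_ h3
    rw [pow_succ, mul_add, mul_assoc]
    linarith

/-- The mean number of steps before `K` at which the killed motion is alive. -/
noncomputable def lifetime (M N : ℕ) [NeZero N] (p₀ : ℝ) (K : ℕ) : Cell → ℝ :=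
  ∑ t ∈ Finset.range K, (killedOp M N p₀ ^ t) 1

theorem lifetime_nonneg (h0 : 0 < p₀) (h1 : p₀ < 1) (K : ℕ) : 0 ≤ lifetime M N p₀ K :=
  Finset.sum_nonneg (fun t _ => killedOp_pow_one_nonneg h0 h1 t)

theorem lifetime_le (hM : 2 ≤ M) (h0 : 0 < p₀) (h1 : p₀ < 1) (K : ℕ) (c : Cell) :
    lifetime M N p₀ K c ≤ K := by
  rw [lifetime, Finset.sum_apply]
  refine (Finset.sum_le_sum (fun t _ => killedOp_pow_one_le hM h0 h1 t c)).trans ?_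
  simp

theorem lifetime_sub_one_le (h0 : 0 < p₀) (h1 : p₀ < 1) (K : ℕ) (c : Cell) :
    lifetime M N p₀ K c - 1 ≤ killedOp M N p₀ (lifetime M N p₀ K) c := by
  have e : lifetime M N p₀ K + (killedOp M N p₀ ^ K) 1 =
      killedOp M N p₀ (lifetime M N p₀ K) + 1 := by
    rw [lifetime, ← Finset.sum_range_succ, Finset.sum_range_succ', map_sum]
    simp [pow_succ']
  have e' := congrFun e c
  have := killedOp_pow_one_nonneg (M := M) (N := N) h0 h1 K c
  simp only [Pi.add_apply, Pi.one_apply, Pi.zero_apply] at e' this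
  linarith

/-- The killed motion started from `[0,1)` has infinite mean lifetime: the survival probability
at time `t` is at least a multiple of `1 / t`, because the mean depth stays above `1` while the
depth is at most linear in `t`. -/
theorem exists_lt_lifetime (hM : 2 ≤ M) (hN : 2 ≤ N) (h0 : 0 < p₀) (h1 : p₀ < 1)
    (hL : lyapunov M N p₀ = 0) (R : ℝ) : ∃ K : ℕ, R < lifetime M N p₀ K root := by
  obtain ⟨H, hH⟩ := exists_one_le_cellMean_depth hM hN h0 h1 hL
  have hlog : 0 < Real.log M := Real.log_pos (by exact_mod_cast hM)
  have h2 : 0 < 1 - p₀ := by linarith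
  have hmean : ∀ t : ℕ, 1 ≤ (H + t) * Real.log M * cellMean M N p₀ H t 1 := by
    intro t
    refine (hH t).trans ?_
    rw [cellMean_apply, cellMean_apply]
    refine (pow_mono contractOp_mono H (killedOp_pow_depth_le hM h0 h1 t) root).trans
      (le_of_eq ?_)
    rw [contractOp_pow_depth_mul, depth_root]
    ring
  set b : ℝ := (1 - p₀) ^ H / ((H + 1) * Real.log M) with hb
  have hb0 : 0 < b := by positivity
  have hterm : ∀ t : ℕ, b * (1 / ((t : ℝ) + 1)) ≤ (killedOp M N p₀ ^ (H + t)) 1 root := by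
    intro t
    have hpos : 0 ≤ cellMean M N p₀ H t 1 := by
      have := cellMean_mono (M := M) (N := N) h0 h1 H t (zero_le_one : (0 : Cell → ℝ) ≤ 1)
      rwa [map_zero] at this
    have hS : 1 ≤ ((H + 1) * Real.log M) * ((t + 1) * cellMean M N p₀ H t 1) := by
      refine (hmean t).trans ?_
      have : ((H : ℝ) + t) ≤ (H + 1) * (t + 1) := by
        have : 0 ≤ (H : ℝ) * t := by positivity
        linarith
      calc ((H : ℝ) + t) * Real.log M * cellMean M N p₀ H t 1
          ≤ ((H + 1) * (t + 1)) * Real.log M * cellMean M N p₀ H t 1 := by gcongr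
        _ = _ := by ring
    have h3 := contractOp_pow_le_killedOp_pow (M := M) (N := N) h0 h1 H
      (killedOp_pow_one_nonneg (M := M) (N := N) h0 h1 t) root
    rw [← Module.End.mul_apply (killedOp M N p₀ ^ H), ← pow_add] at h3
    refine le_trans ?_ h3
    rw [Pi.smul_apply, smul_eq_mul, ← cellMean_apply, hb, div_mul_div_comm, mul_one,
      div_le_iff₀ (by positivity)]
    have := mul_le_mul_of_nonneg_left hS (pow_nonneg h2.le H)
    linarith
  obtain ⟨K, hK⟩ := (Real.tendsto_sum_range_one_div_nat_succ_atTop.eventually_gt_atTop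
    (R / b)).exists
  rw [div_lt_iff₀' hb0] at hK
  refine ⟨H + K, hK.trans_le ?_⟩
  rw [lifetime, Finset.sum_apply, Finset.sum_range_add, Finset.mul_sum]
  refine (Finset.sum_le_sum (fun t _ => hterm t)).trans (le_add_of_nonneg_left ?_)
  exact Finset.sum_nonneg (fun t _ => killedOp_pow_one_nonneg h0 h1 t root)

end survival

/-! ### A strong law for bounded martingale differences -/

section largeNumbers

variable {M : ℕ} {p₀ : ℝ}

theorem exists_comp_range_of_dependsOn {n : ℕ} {β : Type*} {f : (ℕ → Fin (M + 1)) → β}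
    (hf : DependsOn f (Finset.range n : Set ℕ)) :
    ∃ g : (Finset.range n → Fin (M + 1)) → β, f = fun ω => g (fun i => ω i) := by
  refine ⟨fun r => f (fun i => if h : i ∈ Finset.range n then r ⟨i, h⟩ else 0), ?_⟩
  ext1 ω
  refine hf (fun i hi => ?_)
  rw [dif_pos (Finset.mem_coe.1 hi)]

theorem measurable_of_dependsOn_range {n : ℕ} {β : Type*} [MeasurableSpace β]
    {f : (ℕ → Fin (M + 1)) → β} (hf : DependsOn f (Finset.range n : Set ℕ)) : Measurable f := by
  obtain ⟨g, rfl⟩ := exists_comp_range_of_dependsOn hf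
  exact (measurable_of_finite g).comp (measurable_pi_lambda _ (fun i => measurable_pi_apply _))

theorem isProbabilityMeasure_bernoulli (hM : 2 ≤ M) (h0 : 0 < p₀) (h1 : p₀ < 1) :
    IsProbabilityMeasure (bernoulli M p₀) := by
  have := isProbabilityMeasure_symbolLaw M hM p₀ h0 h1
  unfold bernoulli
  infer_instance

theorem symbolLaw_singleton (i : Fin (M + 1)) :
    symbolLaw M p₀ {i} = ENNReal.ofReal (weight M p₀ i) := by
  simp only [symbolLaw, Measure.coe_finsetSum, Finset.sum_apply, Measure.smul_apply, smul_eq_mul]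
  rw [Finset.sum_eq_single i]
  · simp
  · intro j _ hj
    simp [hj]
  · simp

/-- The symbol at time `n` is independent of the earlier ones, so it can be averaged out. -/
theorem lintegral_bernoulli_eq (hM : 2 ≤ M) (h0 : 0 < p₀) (h1 : p₀ < 1) (n : ℕ)
    (F : Fin (M + 1) → (ℕ → Fin (M + 1)) → ENNReal)
    (hF : ∀ i, DependsOn (F i) (Finset.range n : Set ℕ)) :
    ∫⁻ ω, F (ω n) ω ∂(bernoulli M p₀) =
      ∫⁻ ω, ∑ i, ENNReal.ofReal (weight M p₀ i) * F i ω ∂(bernoulli M p₀) := by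
  have := isProbabilityMeasure_symbolLaw M hM p₀ h0 h1
  have hind : iIndepFun (fun (k : ℕ) (ω : ℕ → Fin (M + 1)) => ω k) (bernoulli M p₀) :=
    iIndepFun_infinitePi (P := fun _ : ℕ => symbolLaw M p₀) (X := fun _ => id)
      (fun _ => measurable_id)
  have hpair := hind.indepFun_finset {n} (Finset.range n) (by simp) (fun i => measurable_pi_apply i)
  set e : Fin (M + 1) → (ℕ → Fin (M + 1)) → ENNReal :=
    fun i ω => ({i} : Set (Fin (M + 1))).indicator 1 (ω n) with he
  have hem : ∀ i, Measurable (e i) := fun i =>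
    (measurable_of_finite (({i} : Set (Fin (M + 1))).indicator (1 : Fin (M + 1) → ENNReal))).comp
      (measurable_pi_apply n)
  have hei : ∀ i, ∫⁻ ω, e i ω ∂(bernoulli M p₀) = ENNReal.ofReal (weight M p₀ i) := by
    intro i
    have hmap : Measure.map (fun ω : ℕ → Fin (M + 1) => ω n) (bernoulli M p₀) = symbolLaw M p₀ :=
      Measure.infinitePi_map_eval _ n
    rw [← symbolLaw_singleton, ← hmap, ← lintegral_indicator_one (measurableSet_singleton i),
      lintegral_map (measurable_of_finite _) (measurable_pi_apply n)]
  have hsplit : ∀ ω, F (ω n) ω = ∑ i, e i ω * F i ω := by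
    intro ω
    rw [Finset.sum_eq_single (ω n)]
    · simp [he]
    · intro j _ hj
      simp [he, hj.symm]
    · simp
  simp_rw [hsplit]
  have hprod : ∀ i, Measurable (fun ω => e i ω * F i ω) := fun i =>
    (hem i).mul (measurable_of_dependsOn_range (hF i))
  rw [lintegral_finsetSum _ (fun i _ => hprod i),
    lintegral_finsetSum _ (fun i _ => (measurable_of_dependsOn_range (hF i)).const_mul _)]
  refine Finset.sum_congr rfl (fun i _ => ?_)
  rw [lintegral_const_mul _ (measurable_of_dependsOn_range (hF i)), ← hei i]
  refine lintegral_mul_eq_lintegral_mul_lintegral_of_indepFun (hem i)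
    (measurable_of_dependsOn_range (hF i)) ?_
  obtain ⟨g, hg⟩ := exists_comp_range_of_dependsOn (hF i)
  rw [hg]
  exact hpair.comp (φ := fun r => ({i} : Set (Fin (M + 1))).indicator (1 : Fin (M + 1) → ENNReal)
    (r ⟨n, Finset.mem_singleton_self n⟩)) (ψ := g) (measurable_of_finite _) (measurable_of_finite _)

/-- One-sided strong law for bounded martingale differences `ψ k ω (ω k)`, where `ψ k` depends on
the symbols before time `k` and has mean zero in the next symbol: an exponential moment bound,
Markov's inequality and the Borel–Cantelli lemma. -/
theorem ae_eventually_sum_le (hM : 2 ≤ M) (h0 : 0 < p₀) (h1 : p₀ < 1)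
    (ψ : ℕ → (ℕ → Fin (M + 1)) → Fin (M + 1) → ℝ)
    (hdep : ∀ k, DependsOn (ψ k) (Finset.range k : Set ℕ))
    (hmean : ∀ k ω, ∑ i, weight M p₀ i * ψ k ω i = 0)
    {B : ℝ} (hB : ∀ k ω i, |ψ k ω i| ≤ B) {δ : ℝ} (hδ : 0 < δ) :
    ∀ᵐ ω ∂(bernoulli M p₀), ∀ᶠ n : ℕ in atTop,
      ∑ k ∈ Finset.range n, ψ k ω (ω k) ≤ δ * n := by
  have := isProbabilityMeasure_bernoulli hM h0 h1
  wlog hBδ : δ ≤ B generalizing B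
  · exact this (B := max B δ) (fun k ω i => (hB k ω i).trans (le_max_left _ _)) (le_max_right _ _)
  have hB0 : 0 < B := hδ.trans_le hBδ
  -- This `a` minimizes the exponent `a ^ 2 * B ^ 2 - a * δ` of the tail bound.
  set a : ℝ := δ / (2 * B ^ 2) with ha
  have ha0 : 0 < a := by positivity
  have haB : a * B ≤ 1 := by
    rw [ha, div_mul_eq_mul_div, div_le_one (by positivity)]
    nlinarith
  have haB2 : a ^ 2 * B ^ 2 = a * δ / 2 := by
    rw [ha]; field_simp
  set S : ℕ → (ℕ → Fin (M + 1)) → ℝ := fun n ω => ∑ k ∈ Finset.range n, ψ k ω (ω k) with hS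
  have hSdep : ∀ n, DependsOn (S n) (Finset.range n : Set ℕ) := by
    intro n ω ω' h
    refine Finset.sum_congr rfl (fun k hk => ?_)
    have hkn := Finset.mem_range.1 hk
    rw [hdep k (fun i hi => h i (by
      simp only [Finset.coe_range, Set.mem_Iio] at hi ⊢; omega)), h k (Finset.mem_coe.2 hk)]
  have hexp : ∀ k ω, ∑ i, weight M p₀ i * Real.exp (a * ψ k ω i) ≤ Real.exp (a * δ / 2) := by
    intro k ω
    have hterm : ∀ i, Real.exp (a * ψ k ω i) ≤ 1 + a * ψ k ω i + a ^ 2 * B ^ 2 := by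
      intro i
      have hle : |a * ψ k ω i| ≤ a * B := by
        rw [abs_mul, abs_of_pos ha0]
        exact mul_le_mul_of_nonneg_left (hB k ω i) ha0.le
      have h3 := (abs_le.1 (Real.abs_exp_sub_one_sub_id_le (hle.trans haB))).2
      have h4 : (a * ψ k ω i) ^ 2 ≤ (a * B) ^ 2 := by
        rw [← sq_abs]; gcongr
      linarith [mul_pow a B 2]
    calc ∑ i, weight M p₀ i * Real.exp (a * ψ k ω i)
        ≤ ∑ i, weight M p₀ i * (1 + a * ψ k ω i + a ^ 2 * B ^ 2) :=
          Finset.sum_le_sum (fun i _ =>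
            mul_le_mul_of_nonneg_left (hterm i) (weight_nonneg M p₀ h0 h1 i))
      _ = (∑ i, weight M p₀ i) * (1 + a ^ 2 * B ^ 2) + a * ∑ i, weight M p₀ i * ψ k ω i := by
          rw [Finset.sum_mul, Finset.mul_sum, ← Finset.sum_add_distrib]
          exact Finset.sum_congr rfl (fun i _ => by ring)
      _ = a * δ / 2 + 1 := by rw [sum_weight M hM, hmean, haB2]; ring
      _ ≤ _ := Real.add_one_le_exp _
  have hmoment : ∀ n, ∫⁻ ω, ENNReal.ofReal (Real.exp (a * S n ω)) ∂(bernoulli M p₀) ≤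
      ENNReal.ofReal (Real.exp (n * (a * δ / 2))) := by
    intro n
    induction n with
    | zero => simp [hS]
    | succ n ih =>
      set F : Fin (M + 1) → (ℕ → Fin (M + 1)) → ENNReal := fun i ω =>
        ENNReal.ofReal (Real.exp (a * (S n ω + ψ n ω i))) with hF
      have hFdep : ∀ i, DependsOn (F i) (Finset.range n : Set ℕ) := by
        intro i ω ω' h
        simp only [hF, hSdep n h, hdep n h]
      have e : ∀ ω, ENNReal.ofReal (Real.exp (a * S (n + 1) ω)) = F (ω n) ω := by
        intro ω
        simp only [hF, hS, Finset.sum_range_succ]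
      simp_rw [e]
      rw [lintegral_bernoulli_eq hM h0 h1 n F hFdep]
      calc ∫⁻ ω, ∑ i, ENNReal.ofReal (weight M p₀ i) * F i ω ∂(bernoulli M p₀)
          ≤ ∫⁻ ω, ENNReal.ofReal (Real.exp (a * δ / 2)) *
              ENNReal.ofReal (Real.exp (a * S n ω)) ∂(bernoulli M p₀) := by
            refine lintegral_mono (fun ω => ?_)
            simp only [hF]
            simp_rw [← ENNReal.ofReal_mul (weight_nonneg M p₀ h0 h1 _)]
            rw [← ENNReal.ofReal_sum_of_nonneg (fun i _ => mul_nonneg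
              (weight_nonneg M p₀ h0 h1 i) (Real.exp_nonneg _)),
              ← ENNReal.ofReal_mul (Real.exp_nonneg _)]
            refine ENNReal.ofReal_le_ofReal ?_
            have := mul_le_mul_of_nonneg_right (hexp n ω) (Real.exp_nonneg (a * S n ω))
            refine le_trans (le_of_eq ?_) this
            rw [Finset.sum_mul]
            refine Finset.sum_congr rfl (fun i _ => ?_)
            rw [mul_add, Real.exp_add]
            ring
        _ ≤ ENNReal.ofReal (Real.exp (a * δ / 2)) *
              ENNReal.ofReal (Real.exp (n * (a * δ / 2))) := by
            rw [lintegral_const_mul' _ _ ENNReal.ofReal_ne_top]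
            gcongr
        _ = _ := by
            rw [← ENNReal.ofReal_mul (Real.exp_nonneg _), ← Real.exp_add]
            congr 2
            push_cast
            ring
  have htail : ∀ n : ℕ, bernoulli M p₀ {ω | δ * n < S n ω} ≤
      ENNReal.ofReal (Real.exp (-(a * δ / 2)) ^ n) := by
    intro n
    have hmeas : Measurable (fun ω => ENNReal.ofReal (Real.exp (a * S n ω))) :=
      measurable_of_dependsOn_range (n := n) (fun ω ω' h => by simp only [hSdep n h])
    have h3 := (mul_meas_ge_le_lintegral hmeas (μ := bernoulli M p₀)
      (ENNReal.ofReal (Real.exp (a * (δ * n))))).trans (hmoment n)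
    have h4 : bernoulli M p₀ {ω | δ * n < S n ω} ≤ bernoulli M p₀
        {ω | ENNReal.ofReal (Real.exp (a * (δ * n))) ≤ ENNReal.ofReal (Real.exp (a * S n ω))} := by
      refine measure_mono (fun ω hω => ?_)
      refine ENNReal.ofReal_le_ofReal (Real.exp_le_exp.2 ?_)
      exact mul_le_mul_of_nonneg_left (le_of_lt hω) ha0.le
    refine h4.trans ?_
    have hpos : ENNReal.ofReal (Real.exp (a * (δ * n))) ≠ 0 := by
      simp [Real.exp_pos]
    rw [← ENNReal.mul_le_mul_iff_right hpos ENNReal.ofReal_ne_top]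
    refine h3.trans (le_of_eq ?_)
    rw [← ENNReal.ofReal_mul (Real.exp_nonneg _), ← Real.exp_nat_mul, ← Real.exp_add]
    congr 2
    ring
  have hsum : ∑' n : ℕ, bernoulli M p₀ {ω | δ * n < S n ω} ≠ ⊤ := by
    refine ne_top_of_le_ne_top ?_ (ENNReal.tsum_le_tsum htail)
    refine Summable.tsum_ofReal_ne_top (summable_geometric_of_lt_one (Real.exp_nonneg _) ?_)
    rw [Real.exp_lt_one_iff]
    have : 0 < a * δ := by positivity
    linarith
  filter_upwards [ae_eventually_notMem hsum] with ω hω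
  filter_upwards [hω] with n hn
  exact not_lt.1 hn

end largeNumbers

/-! ### Frequencies along the motion with resets -/

open Classical in
/-- The indicator that the symbol `i` resets the cell `c`. -/
noncomputable def reset {M : ℕ} (N : ℕ) (c : Cell) (i : Fin (M + 1)) : ℝ :=
  if i = 0 ∧ c.Cut N then 1 else 0

theorem reset_nonneg {M N : ℕ} (c : Cell) (i : Fin (M + 1)) : 0 ≤ reset N c i := by
  unfold reset; split_ifs <;> norm_num

theorem reset_le_one {M N : ℕ} (c : Cell) (i : Fin (M + 1)) : reset N c i ≤ 1 := by
  unfold reset; split_ifs <;> norm_num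

section trajectory

variable {M N : ℕ} [NeZero N] {p₀ : ℝ}

open Classical in
/-- One step of the motion of cells: a cell is replaced by its image, except that it is reset to
`[0,1)` when the `N`-adic map cuts it. -/
noncomputable def step (M N : ℕ) [NeZero N] (c : Cell) : Fin (M + 1) → Cell :=
  Fin.cases (if h : c.Cut N then root else c.expand N h) c.contract

/-- The cell at time `n`, started from `[0,1)`; it contains the orbits of all points at once. -/
noncomputable def cellAt (M N : ℕ) [NeZero N] (ω : ℕ → Fin (M + 1)) : ℕ → Cell
  | 0 => root
  | n + 1 => step M N (cellAt M N ω n) (ω n)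

theorem dependsOn_cellAt (n : ℕ) :
    DependsOn (fun ω => cellAt M N ω n) (Finset.range n : Set ℕ) := by
  induction n with
  | zero => intro ω ω' _; rfl
  | succ n ih =>
    intro ω ω' h
    simp only [cellAt]
    have e : cellAt M N ω n = cellAt M N ω' n := ih (fun i hi => h i (by
      simp only [Finset.coe_range, Set.mem_Iio] at hi ⊢; omega))
    rw [h n (by simp), e]

theorem contains_step {c : Cell} {x : ℝ} (hc : c.Contains x) (i : Fin (M + 1)) :
    (step M N c i).Contains (ifsMap M N i x) := by
  have hx : x ∈ Set.Ico (0 : ℝ) 1 :=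
    ⟨c.left_nonneg.trans hc.1, hc.2.trans_le c.add_le_one⟩
  obtain ⟨hc1, hc2⟩ := hc
  induction i using Fin.cases with
  | zero =>
    have hm := ifsMap_mapsTo M N 0 hx
    simp only [step, Fin.cases_zero]
    split_ifs with h
    · exact ⟨hm.1, by simpa [root] using hm.2⟩
    · have hN : (0 : ℝ) < N := by exact_mod_cast Nat.pos_of_ne_zero (NeZero.ne N)
      have hf := Int.floor_add_fract ((N : ℝ) * c.left)
      have h1 := Int.fract_nonneg ((N : ℝ) * c.left)
      have h2 := not_lt.1 h
      have h3 : (N : ℝ) * c.left ≤ N * x := by gcongr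
      have h4 : (N : ℝ) * x < N * c.left + N * c.len := by
        rw [← mul_add]; gcongr
      have hfl : ⌊(N : ℝ) * x⌋ = ⌊(N : ℝ) * c.left⌋ := by
        rw [Int.floor_eq_iff]; constructor <;> linarith
      have hfr : Int.fract ((N : ℝ) * x) = N * x - ⌊(N : ℝ) * c.left⌋ := by rw [← hfl]; rfl
      simp only [ifsMap, if_true, Contains, expand, hfr]
      constructor <;> linarith
  | succ j =>
    have hM : (0 : ℝ) < M := by exact_mod_cast j.pos
    simp only [step, Fin.cases_succ, ifsMap, Fin.succ_ne_zero, if_false, Contains, contract,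
      Fin.val_succ]
    push_cast
    rw [← add_div]
    constructor
    · gcongr; linarith
    · gcongr; linarith

theorem contains_cellAt (ω : ℕ → Fin (M + 1)) {x : ℝ} (hx : x ∈ Set.Ico (0 : ℝ) 1) (n : ℕ) :
    (cellAt M N ω n).Contains (iter M N ω n x) := by
  induction n with
  | zero => exact ⟨hx.1, by simpa [cellAt, iter, root] using hx.2⟩
  | succ n ih => exact contains_step ih _

theorem abs_iter_sub_lt (ω : ℕ → Fin (M + 1)) {x y : ℝ} (hx : x ∈ Set.Ico (0 : ℝ) 1)
    (hy : y ∈ Set.Ico (0 : ℝ) 1) (n : ℕ) :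
    |iter M N ω n x - iter M N ω n y| < (cellAt M N ω n).len := by
  have h1 := contains_cellAt (N := N) ω hx n
  have h2 := contains_cellAt (N := N) ω hy n
  rw [abs_lt]
  constructor <;> linarith [h1.1, h1.2, h2.1, h2.2]

/-- The mean of an observable over one step of the unkilled motion. -/
theorem sum_weight_step (F : Cell → ℝ) (c : Cell) :
    ∑ i, weight M p₀ i * F (step M N c i) =
      killedOp M N p₀ F c + (∑ i, weight M p₀ i * reset N c i) * F root := by
  classical
  have h1 : ∑ i, weight M p₀ i * reset N c i = p₀ * if c.Cut N then 1 else 0 := by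
    rw [Fin.sum_univ_succ]
    simp [weight, reset]
  rw [h1, Fin.sum_univ_succ, killedOp_apply]
  simp only [step, Fin.cases_zero, Fin.cases_succ, weight, if_true, Fin.succ_ne_zero, if_false,
    contractOp, expandOp, LinearMap.coe_mk, AddHom.coe_mk, ← Finset.mul_sum]
  split_ifs <;> ring

/-- The strong law along the trajectory of cells. -/
theorem ae_eventually_sum_cellAt_le (hM : 2 ≤ M) (h0 : 0 < p₀) (h1 : p₀ < 1)
    (φ : Cell → Fin (M + 1) → ℝ) {B : ℝ} (hB : ∀ c i, |φ c i| ≤ B) {δ : ℝ} (hδ : 0 < δ) :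
    ∀ᵐ ω ∂(bernoulli M p₀), ∀ᶠ n : ℕ in atTop,
      ∑ k ∈ Finset.range n, φ (cellAt M N ω k) (ω k) ≤
        ∑ k ∈ Finset.range n, ∑ i, weight M p₀ i * φ (cellAt M N ω k) i + δ * n := by
  have hmean : ∀ c, |∑ i, weight M p₀ i * φ c i| ≤ B := by
    intro c
    refine (Finset.abs_sum_le_sum_abs _ _).trans ?_
    calc ∑ i, |weight M p₀ i * φ c i| ≤ ∑ i, weight M p₀ i * B := by
          refine Finset.sum_le_sum (fun i _ => ?_)
          rw [abs_mul, abs_of_nonneg (weight_nonneg M p₀ h0 h1 i)]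
          exact mul_le_mul_of_nonneg_left (hB c i) (weight_nonneg M p₀ h0 h1 i)
      _ = B := by rw [← Finset.sum_mul, sum_weight M hM, one_mul]
  have key := ae_eventually_sum_le hM h0 h1
    (fun k ω i => φ (cellAt M N ω k) i - ∑ j, weight M p₀ j * φ (cellAt M N ω k) j)
    (fun k ω ω' h => by
      have e : cellAt M N ω k = cellAt M N ω' k := dependsOn_cellAt k h
      simp only [e])
    (fun k ω => by
      simp only [mul_sub, Finset.sum_sub_distrib]
      rw [← Finset.sum_mul, sum_weight M hM, one_mul, sub_self])
    (B := B + B) (fun k ω i => (abs_sub _ _).trans (add_le_add (hB _ _) (hmean _))) hδ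
  filter_upwards [key] with ω hω
  filter_upwards [hω] with n hn
  rw [Finset.sum_sub_distrib] at hn
  linarith

/-- Resets have zero frequency. With `G` the mean lifetime before time `K`, the process
`G * (number of resets) - n - lifetime (cell at time n)` is a supermartingale. -/
theorem ae_eventually_sum_reset_le (hM : 2 ≤ M) (hN : 2 ≤ N) (h0 : 0 < p₀) (h1 : p₀ < 1)
    (hL : lyapunov M N p₀ = 0) {δ : ℝ} (hδ : 0 < δ) :
    ∀ᵐ ω ∂(bernoulli M p₀), ∀ᶠ n : ℕ in atTop,
      ∑ k ∈ Finset.range n, reset N (cellAt M N ω k) (ω k) ≤ δ * n := by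
  obtain ⟨K, hK⟩ := exists_lt_lifetime (N := N) hM hN h0 h1 hL (3 / δ)
  set V := lifetime M N p₀ K with hV
  set G := V root with hG
  have hG0 : 0 < G := lt_trans (by positivity) hK
  have hV0 : ∀ c, 0 ≤ V c := lifetime_nonneg h0 h1 K
  have hVK : ∀ c, V c ≤ K := lifetime_le hM h0 h1 K
  have key := ae_eventually_sum_cellAt_le (N := N) hM h0 h1
    (fun c i => G * reset N c i - V (step M N c i)) (B := G + K) (fun c i => by
      have h3 := reset_nonneg (N := N) c i
      have h4 := reset_le_one (N := N) c i
      have h5 := hV0 (step M N c i)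
      have h6 := hVK (step M N c i)
      rw [abs_le]
      constructor <;> nlinarith) one_pos
  have hmean : ∀ c, ∑ i, weight M p₀ i * (G * reset N c i - V (step M N c i)) ≤ 1 - V c := by
    intro c
    have h3 := sum_weight_step (M := M) (N := N) (p₀ := p₀) V c
    have h4 := lifetime_sub_one_le (M := M) (N := N) h0 h1 K c
    have h5 : ∑ i, weight M p₀ i * (G * reset N c i) =
        (∑ i, weight M p₀ i * reset N c i) * G := by
      rw [Finset.sum_mul]
      exact Finset.sum_congr rfl (fun i _ => by ring)
    simp only [mul_sub, Finset.sum_sub_distrib]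
    rw [h3, h5]
    linarith
  filter_upwards [key] with ω hω
  filter_upwards [hω, eventually_ge_atTop K] with n hn hnK
  have h3 := Finset.sum_le_sum (s := Finset.range n) (fun k _ => hmean (cellAt M N ω k))
  have h4 : ∑ k ∈ Finset.range n, (V (cellAt M N ω (k + 1)) - V (cellAt M N ω k)) =
      V (cellAt M N ω n) - V (cellAt M N ω 0) :=
    Finset.sum_range_sub (fun k => V (cellAt M N ω k)) n
  have h5 : ∀ k, step M N (cellAt M N ω k) (ω k) = cellAt M N ω (k + 1) := fun k => rfl
  simp only [h5, Finset.sum_sub_distrib, ← Finset.mul_sum, Finset.sum_const, Finset.card_range,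
    nsmul_eq_mul, mul_one] at hn h3 h4
  have h6 := hVK (cellAt M N ω n)
  have h7 := hV0 (cellAt M N ω 0)
  have hnK' : (K : ℝ) ≤ n := by exact_mod_cast hnK
  have h8 : G * ∑ k ∈ Finset.range n, reset N (cellAt M N ω k) (ω k) ≤ 3 * n := by linarith
  rw [div_lt_iff₀ hδ] at hK
  refine le_of_mul_le_mul_left (h8.trans ?_) hG0
  rw [← mul_assoc]
  gcongr

open Classical in
/-- The indicator that the cell has length at least `ε`. -/
noncomputable def long (ε : ℝ) (c : Cell) : ℝ := if ε ≤ c.len then 1 else 0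

open Classical in
/-- Long cells have zero frequency: with probability `p₀` a long cell is either reset or made `N`
times longer in the next step, and no cell is longer than `1`. -/
theorem ae_eventually_sum_long_le (hM : 2 ≤ M) (hN : 2 ≤ N) (h0 : 0 < p₀) (h1 : p₀ < 1)
    (hL : lyapunov M N p₀ = 0) {ε : ℝ} (hε : 0 < ε) {δ : ℝ} (hδ : 0 < δ) :
    ∀ᵐ ω ∂(bernoulli M p₀), ∀ᶠ n : ℕ in atTop,
      ∑ k ∈ Finset.range n, long ε (cellAt M N ω k) ≤ δ * n := by
  have hN1 : (1 : ℝ) < N := by exact_mod_cast (by omega : 1 < N)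
  obtain ⟨m, hm⟩ := pow_unbounded_of_one_lt (1 / ε) hN1
  rw [div_lt_iff₀ hε] at hm
  induction m generalizing ε δ with
  | zero =>
    refine ae_of_all _ (fun ω => Eventually.of_forall (fun n => ?_))
    rw [Finset.sum_eq_zero]
    · positivity
    · intro k _
      have := (cellAt M N ω k).len_le_one
      rw [long, if_neg]
      simp only [pow_zero, one_mul] at hm
      linarith
  | succ m ih =>
    have hp : 0 < p₀ * δ / 4 := by positivity
    have ih' := ih (ε := N * ε) (by positivity) hp (by rw [← mul_assoc, ← pow_succ]; exact hm)
    have key := ae_eventually_sum_cellAt_le (N := N) hM h0 h1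
      (fun c i => if i = 0 then - long ε c else 0) (B := 1) (fun c i => by
        unfold long; split_ifs <;> simp) hp
    have hmean : ∀ c, ∑ i, weight M p₀ i * (if i = 0 then - long ε c else 0) =
        - (p₀ * long ε c) := by
      intro c
      rw [Fin.sum_univ_succ]
      simp [weight]
    have hpt : ∀ c (i : Fin (M + 1)), (if i = 0 then long ε c else 0) ≤
        reset N c i + long (N * ε) (step M N c i) := by
      intro c i
      have h3 := reset_nonneg (N := N) c i
      have h4 : 0 ≤ long (N * ε) (step M N c i) := by
        unfold long; split_ifs <;> norm_num
      by_cases hi : i = 0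
      · subst hi
        by_cases hc : c.Cut N
        · have h5 : long ε c ≤ 1 := by unfold long; split_ifs <;> norm_num
          have h6 : reset N c (0 : Fin (M + 1)) = 1 := by simp [reset, hc]
          rw [if_pos rfl]
          linarith
        · rw [if_pos rfl]
          refine le_trans (le_of_eq ?_) (le_add_of_nonneg_left h3)
          have h5 : (step M N c 0).len = N * c.len := by
            simp [step, hc, expand]
          have h6 : (N * ε ≤ N * c.len) ↔ ε ≤ c.len := mul_le_mul_iff_right₀ (by linarith)
          simp only [long, h5, h6]
      · rw [if_neg hi]
        positivity
    filter_upwards [ih', key, ae_eventually_sum_reset_le hM hN h0 h1 hL hp] with ω hω1 hω2 hω3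
    filter_upwards [(tendsto_add_atTop_nat 1).eventually hω1, hω2, hω3, eventually_ge_atTop 1]
      with n hn1 hn2 hn3 hn
    have hn' : (1 : ℝ) ≤ n := by exact_mod_cast hn
    have h3 := Finset.sum_le_sum (s := Finset.range n)
      (fun k _ => hpt (cellAt M N ω k) (ω k))
    have h4 : ∑ k ∈ Finset.range n, long (N * ε) (step M N (cellAt M N ω k) (ω k)) ≤
        ∑ k ∈ Finset.range (n + 1), long (N * ε) (cellAt M N ω k) := by
      rw [Finset.sum_range_succ']
      refine le_add_of_nonneg_right ?_
      unfold long; split_ifs <;> norm_num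
    have h5 : ∑ k ∈ Finset.range n, (if ω k = 0 then - long ε (cellAt M N ω k) else 0) =
        - ∑ k ∈ Finset.range n, (if ω k = 0 then long ε (cellAt M N ω k) else 0) := by
      rw [← Finset.sum_neg_distrib]
      exact Finset.sum_congr rfl (fun k _ => by split_ifs <;> simp)
    simp only [hmean, Finset.sum_neg_distrib, ← Finset.mul_sum] at hn2
    rw [Finset.sum_add_distrib] at h3
    rw [h5] at hn2
    push_cast at hn1
    have h6 : p₀ * δ / 4 ≤ p₀ * δ / 4 * n := le_mul_of_one_le_right hp.le hn'
    refine le_of_mul_le_mul_left ?_ h0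
    linarith

end trajectory

end TwoPoint

theorem theoremt (M N : ℕ) (hM : 2 ≤ M) (hN : 2 ≤ N) (p₀ : ℝ) (hp₀ : 0 < p₀) (hp₁ : p₀ < 1)
    (hL : TwoPoint.lyapunov M N p₀ = 0) :
    ∀ ε : ℝ, 0 < ε → ∀ x ∈ Set.Ico (0 : ℝ) 1, ∀ y ∈ Set.Ico (0 : ℝ) 1,
      ∀ᵐ ω ∂(TwoPoint.bernoulli M p₀),
        Tendsto
          (fun n : ℕ => (1 / (n : ℝ)) *
            (((Finset.range n).filter
              (fun i => |TwoPoint.iter M N ω i x - TwoPoint.iter M N ω i y| < ε)).card : ℝ))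
          atTop (𝓝 1) := by
  intro ε hε x hx y hy
  have : NeZero N := ⟨by omega⟩
  have key : ∀ᵐ ω ∂(TwoPoint.bernoulli M p₀), ∀ m : ℕ, ∀ᶠ n : ℕ in atTop,
      ∑ k ∈ Finset.range n, TwoPoint.long ε (TwoPoint.cellAt M N ω k) ≤
        1 / ((m : ℝ) + 1) * n :=
    ae_all_iff.2 (fun m => TwoPoint.ae_eventually_sum_long_le hM hN hp₀ hp₁ hL hε (by positivity))
  filter_upwards [key] with ω hω
  have hcard : ∀ n : ℕ, (n : ℝ) -
      ∑ k ∈ Finset.range n, TwoPoint.long ε (TwoPoint.cellAt M N ω k) ≤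
      (((Finset.range n).filter
        (fun i => |TwoPoint.iter M N ω i x - TwoPoint.iter M N ω i y| < ε)).card : ℝ) := by
    intro n
    have e : (n : ℝ) = ∑ _k ∈ Finset.range n, (1 : ℝ) := by simp
    rw [Finset.card_filter, e, ← Finset.sum_sub_distrib]
    push_cast
    refine Finset.sum_le_sum (fun k _ => ?_)
    have hlt := TwoPoint.abs_iter_sub_lt (N := N) ω hx hy k
    unfold TwoPoint.long
    by_cases h : ε ≤ (TwoPoint.cellAt M N ω k).len
    · rw [if_pos h, sub_self]
      split_ifs <;> norm_num
    · rw [if_neg h, if_pos (hlt.trans (not_le.1 h)), sub_zero]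
  rw [Metric.tendsto_atTop']
  intro δ hδ
  obtain ⟨m, hm⟩ := exists_nat_one_div_lt hδ
  obtain ⟨n₀, hn₀⟩ := eventually_atTop.1 (hω m)
  refine ⟨n₀, fun n hn => ?_⟩
  have hn0 : (0 : ℝ) < n := by exact_mod_cast (by omega : 0 < n)
  have h1 := hn₀ n hn.le
  have h2 := hcard n
  have h3 : (((Finset.range n).filter
      (fun i => |TwoPoint.iter M N ω i x - TwoPoint.iter M N ω i y| < ε)).card : ℝ) ≤ n := by
    exact_mod_cast (Finset.card_filter_le _ _).trans_eq (Finset.card_range n)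
  rw [Real.dist_eq, abs_lt, one_div_mul_eq_div]
  constructor
  · rw [lt_sub_iff_add_lt, lt_div_iff₀ hn0]
    have := mul_lt_mul_of_pos_right hm hn0
    linarith
  · rw [sub_lt_iff_lt_add, div_lt_iff₀ hn0]
    have := mul_pos hδ hn0
    linarith
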